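/- \textbf{Setting.} Let $M$ be a tabular episodic MDP with finite state space $\mathcal S$ ($S=|\mathcal S|$), finite action space $\mathcal A$ ($A=|\mathcal A|$), horizon $H$, an initial state distribution, and transition kernels $P_h(s'\mid s,a)$, $h\in[H]$. An episode is a trajectory $(s_1,a_1,\dots,s_H,a_H,s_{H+1})$; policies are deterministic and step-dependent, and $V^\pi(r,P)=\mathbb E_{P,\pi}\big[\sum_{h=1}^H r_h(s_h,a_h)\big]$. Let $\delta\in(0,1)$, let $E_\varepsilon\ge 1$, let $T_1,\dots,T_K\ge 1$ be stage lengths with $\sum_k T_k\le T$, and put $\iota=\log(2SAHT/\delta)$. \textbf{Private crude exploration.} At the start of each stage $k=1,\dots,K$ an algorithm has an active policy set $\Pi_k$, determined by the information gathered so far. For each $h=1,\dots,H$ in turn it picks, for every $(s,a)$, a policy $\pi^{\mathrm{cru}}_{h,s,a}\in\arg\max_{\pi\in\Pi_k}V^\pi(1_{h,s,a},\hat P)$, where $\hat P=\hat P^{\mathrm{cru},k}$ is the crude estimate below and $1_{h,s,a}$ is the reward that equals $1$ at $(s,a)$ at step $h$ and $0$ otherwise, so that only the layers of $\hat P$ before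 $h$ matter. It then runs $\lfloor T_k/H\rfloor$ episodes; given the past these are independent, and each follows a policy drawn uniformly from $\{\pi^{\mathrm{cru}}_{h,s,a}\}_{(s,a)\in\mathcal S\times\mathcal A}$. From the true counts $N_h(s,a)$, $N_h(s,a,s')$ of visits at step $h$ in this batch, a privatizer releases private counts $\tilde N_h(s,a)$, $\tilde N_h(s,a,s')$. Set $$\mathcal F_k=\{(h,s,a,s'):\tilde N_h(s,a,s')\le 6E_\varepsilon H^2\iota\},$$ add an absorbing state $s_\dagger$ with zero reward, and let $\hat P_h(s'\mid s,a)=\tilde N_h(s,a,s')/\tilde N_h(s,a)$ if $(h,s,a,s')\notin\mathcal F_k$ and $0$ otherwise, with the remaining mass put on $s_\dagger$. \textbf{Absorbing MDP.} $\tilde P=\tilde P^{k}$ is the kernel on $\mathcal S\cup\{s_\dagger\}$ with $\tilde P_h(s'\mid s,a)=P_h(s'\mid s,a)$ for $(h,s,a,s')\notin\mathcal F_k$, $\tilde P_h(s'\mid s,a)=0$ for $(h,s,a,s')\in\mathcal F_k$, $\tilde P_h(s_\dagger\mid s,a)=\sum_{s':(h,s,a,s')\in\mathcal F_k}P_h(s'\mid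 s,a)$ and $\tilde P_h(s_\dagger\mid s_\dagger,a)=1$. \textbf{Private counts.} Assume that with probability at least $1-3\delta$, simultaneously for all $k,h,s,a,s'$, $$N_h(s,a)\le\tilde N_h(s,a)\le N_h(s,a)+E_\varepsilon,\qquad |\tilde N_h(s,a,s')-N_h(s,a,s')|\le E_\varepsilon .$$ \textbf{Claim.} There is a universal constant $C>0$ such that in every such setting, with probability at least $1-7\delta$, for every stage $k$, every $\pi\in\Pi_k$ and every reward function $r'$ with $r'_h(s,a)\in[0,1]$, $$0\;\le\;V^\pi(r',P)-V^\pi(r',\tilde P)\;\le\;C\,\frac{E_\varepsilon S^3AH^5\iota}{T_k}.$$ -/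

import Mathlib

open MeasureTheory ProbabilityTheory

noncomputable section

namespace PrivateRL

/-- A tabular episodic Markov decision process with horizon `H`: an initial distribution and
step-dependent transition probabilities `trans h s a s' = P_h(s' | s, a)`.  (Rewards are kept
separate, since values are considered for arbitrary rewards.) -/
structure EpisodicMDP (S A : Type*) [Fintype S] (H : ℕ) where
  init : S → ℝ
  init_nonneg : ∀ s, 0 ≤ init s
  init_sum : ∑ s, init s = 1
  trans : Fin H → S → A → S → ℝ
  trans_nonneg : ∀ h s a s', 0 ≤ trans h s a s'
  trans_sum : ∀ h s a, ∑ s', trans h s a s' = 1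

/-- Deterministic step-dependent policies. -/
abbrev Policy (S A : Type*) (H : ℕ) : Type _ := Fin H → S → A

/-- Trajectories `(s_1, a_1, …, s_H, a_H, s_{H+1})`: states and actions. -/
abbrev Traj (X A : Type*) (H : ℕ) : Type _ := (Fin (H + 1) → X) × (Fin H → A)

open Classical in
/-- Probability of a trajectory under initial distribution `ν`, transitions `P` and policy `π`. -/
def trajProb {X A : Type*} {H : ℕ} (ν : X → ℝ) (P : Fin H → X → A → X → ℝ)
    (π : Policy X A H) (τ : Traj X A H) : ℝ :=
  ν (τ.1 0) * ∏ h : Fin H,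
    if τ.2 h = π h (τ.1 h.castSucc) then P h (τ.1 h.castSucc) (τ.2 h) (τ.1 h.succ) else 0

open Classical in
/-- The value `V^π(r, P)`: the expected total reward, `E_{P,π}[∑_h r_h(s_h, a_h)]`. -/
def value {X A : Type*} [Fintype X] [Fintype A] {H : ℕ} (ν : X → ℝ)
    (P : Fin H → X → A → X → ℝ) (π : Policy X A H) (r : Fin H → X → A → ℝ) : ℝ :=
  ∑ τ : Traj X A H, trajProb ν P π τ * ∑ h : Fin H, r h (τ.1 h.castSucc) (τ.2 h)

/-- `V^π(r, Q)` for a kernel `Q` on the state space `Option S`, which is `S` with an additional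
absorbing state `none`.  The initial distribution does not charge `none`, the reward in `none`
is zero, and the action played in `none` is an arbitrary fixed one. -/
def valueExt {S A : Type*} [Fintype S] [Fintype A] [Nonempty A] {H : ℕ} (ν : S → ℝ)
    (Q : Fin H → Option S → A → Option S → ℝ) (π : Policy S A H) (r : Fin H → S → A → ℝ) : ℝ :=
  value (fun x => x.elim 0 ν) Q (fun h x => x.elim (Classical.arbitrary A) (π h))
    (fun h x a => x.elim 0 (fun s => r h s a))

open Classical in
/-- The reward function `1_{h,s,a}`. -/
def indicatorReward {S A : Type*} {H : ℕ} (h : Fin H) (s : S) (a : A) : Fin H → S → A → ℝ :=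
  fun h' s' a' => if h' = h ∧ s' = s ∧ a' = a then 1 else 0

open Classical in
/-- The absorbing transition kernel `P̃`: transitions along the tuples in `F` are redirected to the
absorbing state `none`; all other transitions agree with `P`. -/
def absorbingKernel {S A : Type*} [Fintype S] {H : ℕ} (P : Fin H → S → A → S → ℝ)
    (F : Set (Fin H × S × A × S)) : Fin H → Option S → A → Option S → ℝ
  | h, some s, a, some s' => if (h, s, a, s') ∈ F then 0 else P h s a s'
  | h, some s, a, none => ∑ s' : S, if (h, s, a, s') ∈ F then P h s a s' else 0
  | _, none, _, some _ => 0
  | _, none, _, none => 1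

open Classical in
/-- The crude transition estimate built from counts `n2 h s a` of state-action pairs and
`n3 h s a s'` of transitions: the ratio of counts outside `F`, zero on `F`, and the
remaining mass on the absorbing state. -/
def crudeKernel {S A : Type*} [Fintype S] {H : ℕ} (n2 : Fin H → S → A → ℝ)
    (n3 : Fin H → S → A → S → ℝ) (F : Set (Fin H × S × A × S)) :
    Fin H → Option S → A → Option S → ℝ
  | h, some s, a, some s' => if (h, s, a, s') ∈ F then 0 else n3 h s a s' / n2 h s a
  | h, some s, a, none =>
      1 - ∑ s' : S, if (h, s, a, s') ∈ F then 0 else n3 h s a s' / n2 h s a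
  | _, none, _, some _ => 0
  | _, none, _, none => 1

/-- The infrequently visited tuples: those whose (private) count is at most `C₁ E H² ι`
with `C₁ = 6`. -/
def infrequent {S A : Type*} {H : ℕ} (E ι : ℝ) (n3 : Fin H → S → A → S → ℝ) :
    Set (Fin H × S × A × S) :=
  {x | n3 x.1 x.2.1 x.2.2.1 x.2.2.2 ≤ 6 * E * (H : ℝ) ^ 2 * ι}

open Classical in
/-- Number of visits to `(s, a)` at step `h` in a dataset of `n` trajectories. -/
def visits {S A : Type*} {H n : ℕ} (D : Fin n → Traj S A H) (h : Fin H) (s : S) (a : A) : ℕ :=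
  (Finset.univ.filter fun i => (D i).1 h.castSucc = s ∧ (D i).2 h = a).card

open Classical in
/-- Number of transitions from `(s, a)` to `s'` at step `h` in a dataset of `n` trajectories. -/
def visitsNext {S A : Type*} {H n : ℕ} (D : Fin n → Traj S A H) (h : Fin H) (s : S) (a : A)
    (s' : S) : ℕ :=
  (Finset.univ.filter fun i =>
    (D i).1 h.castSucc = s ∧ (D i).2 h = a ∧ (D i).1 h.succ = s').card

/-- Probability of a trajectory when the policy is drawn uniformly among `(pol s a)_{s,a}` at the
start of the episode. -/
def mixtureProb {S A : Type*} [Fintype S] [Fintype A] {H : ℕ} (M : EpisodicMDP S A H)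
    (pol : S → A → Policy S A H) (τ : Traj S A H) : ℝ :=
  (1 / ((Fintype.card S : ℝ) * (Fintype.card A : ℝ))) *
    ∑ s : S, ∑ a : A, trajProb M.init M.trans (pol s a) τ

/-- The logarithmic factor `ι = log (2 S A H T / δ)`. -/
def logFactor (S A : Type*) [Fintype S] [Fintype A] (H T : ℕ) (δ : ℝ) : ℝ :=
  Real.log (2 * (Fintype.card S : ℝ) * (Fintype.card A : ℝ) * (H : ℝ) * (T : ℝ) / δ)

/-- A run, on the probability space `(Ω, μ)`, of a private policy elimination algorithm in the
MDP `M`, with `K` stages of lengths `len k`, private-count error `E` and logarithmic factor `ι`.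
Layer `h` of the crude exploration of stage `k` is batch number `k H + h` (counting from zero).
`hist t` is all the information available before batch `t`; besides earlier batches it may
contain anything else that happened before, such as observed rewards and the fine
exploration of earlier stages. -/
structure Run {S A Ω : Type*} [Fintype S] [Fintype A] [Nonempty A] {H : ℕ}
    (M : EpisodicMDP S A H) [mΩ : MeasurableSpace Ω] (μ : Measure Ω)
    {K : ℕ} (len : Fin K → ℕ) (E ι : ℝ) where
  hist : Filtration ℕ mΩ
  /-- the set `Π_k` of active policies of stage `k` -/
  active : Fin K → Ω → Set (Policy S A H)
  /-- the policies `π^{cru}_{h,s,a}` of stage `k` -/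
  pol : Fin K → Fin H → Ω → S → A → Policy S A H
  /-- the `⌊len k / H⌋` trajectories collected in layer `h` of stage `k` -/
  data : (k : Fin K) → Fin H → Ω → Fin (len k / H) → Traj S A H
  /-- private version of the number of visits to `(h, s, a)` in layer `h` of stage `k` -/
  priv2 : Fin K → Ω → Fin H → S → A → ℝ
  /-- private version of the number of visits to `(h, s, a, s')` in layer `h` of stage `k` -/
  priv3 : Fin K → Ω → Fin H → S → A → S → ℝ
  active_measurable : ∀ (k : Fin K) (Z : Set (Policy S A H)),
    MeasurableSet[hist ((k : ℕ) * H)] {ω | active k ω = Z}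
  pol_measurable : ∀ (k : Fin K) (h : Fin H) (p : S → A → Policy S A H),
    MeasurableSet[hist ((k : ℕ) * H + h)] {ω | pol k h ω = p}
  data_measurable : ∀ (k : Fin K) (h : Fin H) (d : Fin (len k / H) → Traj S A H),
    MeasurableSet[hist ((k : ℕ) * H + h + 1)] {ω | data k h ω = d}
  priv2_measurable : ∀ (k : Fin K) (h : Fin H) (s : S) (a : A),
    Measurable[hist ((k : ℕ) * H + h + 1)] (fun ω => priv2 k ω h s a)
  priv3_measurable : ∀ (k : Fin K) (h : Fin H) (s : S) (a : A) (s' : S),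
    Measurable[hist ((k : ℕ) * H + h + 1)] (fun ω => priv3 k ω h s a s')
  /-- `π^{cru}_{h,s,a}` is an active policy that maximizes the probability of visiting
  `(s, a)` at step `h` under the crude estimate.  This value involves only the steps before
  `h` of the estimate, which are known before layer `h` is run. -/
  pol_argmax : ∀ (k : Fin K) (h : Fin H) (ω : Ω) (s : S) (a : A),
    IsMaxOn
      (fun π => valueExt M.init
        (crudeKernel (priv2 k ω) (priv3 k ω) (infrequent E ι (priv3 k ω))) π
        (indicatorReward h s a))
      (active k ω) (pol k h ω s a) ∧ pol k h ω s a ∈ active k ω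
  /-- Given the past, the trajectories of a layer are independent, and each is generated in `M` by
  a policy drawn uniformly among `(π^{cru}_{h,s,a})_{s,a}`. -/
  data_law : ∀ (k : Fin K) (h : Fin H) (d : Fin (len k / H) → Traj S A H),
    μ⟦{ω | data k h ω = d} | hist ((k : ℕ) * H + h)⟧ =ᵐ[μ]
      fun ω => ∏ i, mixtureProb M (pol k h ω) (d i)

namespace Run

variable {S A Ω : Type*} [Fintype S] [Fintype A] [Nonempty A] {H : ℕ}
  {M : EpisodicMDP S A H} [MeasurableSpace Ω] {μ : Measure Ω}
  {K : ℕ} {len : Fin K → ℕ} {E ι : ℝ}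

/-- The set of infrequently visited tuples of stage `k`. -/
def infreq (R : Run M μ len E ι) (k : Fin K) (ω : Ω) : Set (Fin H × S × A × S) :=
  infrequent E ι (R.priv3 k ω)

/-- The absorbing MDP's transition kernel `P̃` of stage `k`. -/
def absorbing (R : Run M μ len E ι) (k : Fin K) (ω : Ω) :
    Fin H → Option S → A → Option S → ℝ :=
  absorbingKernel M.trans (R.infreq k ω)

/-- The outcome `ω` is one where all private counts have error at most `E`, and the private
state-action counts are optimistic. -/
def CountsAccurate (R : Run M μ len E ι) (ω : Ω) : Prop :=
  ∀ (k : Fin K) (h : Fin H) (s : S) (a : A),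
    ((visits (R.data k h ω) h s a : ℝ) ≤ R.priv2 k ω h s a ∧
      R.priv2 k ω h s a ≤ visits (R.data k h ω) h s a + E) ∧
    ∀ s' : S, |R.priv3 k ω h s a s' - visitsNext (R.data k h ω) h s a s'| ≤ E

end Run

end PrivateRL

end

/-!
Outside an event of probability at most `δ` the counts of every tuple `(h, s, a, s')` are
concentrated.  Each deviation is bounded by applying Markov's inequality to a product, over the
episodes of a batch, of factors whose conditional mean is at most `1`: after a visit to `(s, a)` the
next state is `s'` with probability `P_h(s' | s, a)`, and an episode makes the transition with the
probability it has under the uniform mixture of the exploration policies.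

On the good event a transition that is not infrequent has a large private count, so its crude
estimate agrees with its true probability up to a factor `1 + 5 / H`.  Over the horizon these
factors multiply to at most `exp 5`, so visit probabilities under `P̂` and `P̃` are comparable; as
the exploration policy for `(h, s, a)` maximizes the former, the probability that it visits `(s, a)`
at step `h` is at least `exp (-10)` times that of any active policy in `P̃`.

An infrequent transition has a small count, hence probability `O(E H³ ι / T_k)` under the mixture,
provided that `H ≤ T_k`; otherwise this bound exceeds `1`.  Under an active policy the probability
is larger by a factor of at most `exp 10 * S * A`.  The mass lost by `P̃` is a sum of at most `H S²`
of these probabilities, and it affects the rewards of `H` steps.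
-/

namespace PrivateRL

section Occupancy

variable {X A : Type*} {H : ℕ}

/-- The probability of the path of states `x` when `π` is followed in `P`. -/
noncomputable def pathProb (ν : X → ℝ) (P : Fin H → X → A → X → ℝ) (π : Policy X A H)
    (x : Fin (H + 1) → X) : ℝ :=
  ν (x 0) * ∏ h : Fin H, P h (x h.castSucc) (π h (x h.castSucc)) (x h.succ)

theorem sum_trajProb_mul [Fintype X] [Fintype A] (ν : X → ℝ) (P : Fin H → X → A → X → ℝ)
    (π : Policy X A H) (f : Traj X A H → ℝ) :
    ∑ τ, trajProb ν P π τ * f τ =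
      ∑ x, pathProb ν P π x * f (x, fun h => π h (x h.castSucc)) := by
  classical
  rw [Fintype.sum_prod_type]
  refine Finset.sum_congr rfl fun x _ => ?_
  rw [Fintype.sum_eq_single (fun h => π h (x h.castSucc))]
  · simp [trajProb, pathProb]
  · intro b hb
    obtain ⟨h, hh⟩ := Function.ne_iff.1 hb
    have hzero : trajProb ν P π (x, b) = 0 := by
      rw [trajProb, Finset.prod_eq_zero (Finset.mem_univ h) (if_neg hh), mul_zero]
    rw [hzero, zero_mul]

theorem pathProb_snoc (ν : X → ℝ) (P : Fin (H + 1) → X → A → X → ℝ) (π : Policy X A (H + 1))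
    (x : Fin (H + 1) → X) (y : X) :
    pathProb ν P π (Fin.snoc (α := fun _ => X) x y) =
      pathProb ν (fun h => P h.castSucc) (fun h => π h.castSucc) x *
        P (Fin.last H) (x (Fin.last H)) (π (Fin.last H) (x (Fin.last H))) y := by
  have hzero : (Fin.snoc (α := fun _ => X) x y : Fin (H + 2) → X) 0 = x 0 := by
    rw [← Fin.castSucc_zero, Fin.snoc_castSucc]
  simp only [pathProb, Fin.prod_univ_castSucc, hzero, Fin.snoc_castSucc, Fin.succ_last,
    Fin.snoc_last, ← Fin.castSucc_succ, mul_assoc]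

variable [Fintype X]

theorem sum_pathProb_mul_snoc (ν : X → ℝ) (P : Fin (H + 1) → X → A → X → ℝ)
    (π : Policy X A (H + 1)) (f : (Fin (H + 2) → X) → ℝ) :
    ∑ x, pathProb ν P π x * f x =
      ∑ x, pathProb ν (fun h => P h.castSucc) (fun h => π h.castSucc) x *
        ∑ y, P (Fin.last H) (x (Fin.last H)) (π (Fin.last H) (x (Fin.last H))) y *
          f (Fin.snoc (α := fun _ => X) x y) := by
  rw [← (Fin.snocEquiv (fun _ : Fin (H + 2) => X)).sum_comp, Fintype.sum_prod_type,
    Finset.sum_comm]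
  refine Finset.sum_congr rfl fun x _ => ?_
  rw [Finset.mul_sum]
  refine Finset.sum_congr rfl fun y _ => ?_
  rw [← mul_assoc, ← pathProb_snoc]
  rfl

/-- The occupancy measure: `occupancy ν P π i s` is the probability of being in state `s` after
`i` steps of `π` in `P`.  The kernel `P` may be substochastic, in which case mass is lost. -/
noncomputable def occupancy (ν : X → ℝ) (P : Fin H → X → A → X → ℝ) (π : Policy X A H) :
    Fin (H + 1) → X → ℝ :=
  Fin.induction ν fun h d s' => ∑ s, d s * P h s (π h s) s'

@[simp]
theorem occupancy_zero (ν : X → ℝ) (P : Fin H → X → A → X → ℝ) (π : Policy X A H) :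
    occupancy ν P π 0 = ν :=
  rfl

theorem occupancy_succ (ν : X → ℝ) (P : Fin H → X → A → X → ℝ) (π : Policy X A H) (h : Fin H)
    (s' : X) :
    occupancy ν P π h.succ s' = ∑ s, occupancy ν P π h.castSucc s * P h s (π h s) s' :=
  rfl

theorem sum_occupancy_succ_mul (ν : X → ℝ) (P : Fin H → X → A → X → ℝ) (π : Policy X A H)
    (h : Fin H) (g : X → ℝ) :
    ∑ s', occupancy ν P π h.succ s' * g s' =
      ∑ s, occupancy ν P π h.castSucc s * ∑ s', P h s (π h s) s' * g s' := by
  simp only [occupancy_succ, Finset.sum_mul, Finset.mul_sum, mul_assoc]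
  exact Finset.sum_comm

theorem occupancy_castSucc (ν : X → ℝ) (P : Fin (H + 1) → X → A → X → ℝ)
    (π : Policy X A (H + 1)) (i : Fin (H + 1)) :
    occupancy ν P π i.castSucc =
      occupancy ν (fun h => P h.castSucc) (fun h => π h.castSucc) i := by
  induction i using Fin.induction with
  | zero => rfl
  | succ h ih =>
    funext s'
    rw [Fin.castSucc_succ, occupancy_succ, occupancy_succ, ih]

theorem sum_pathProb_mul_last (ν : X → ℝ) (P : Fin H → X → A → X → ℝ) (π : Policy X A H)
    (g : X → ℝ) :
    ∑ x, pathProb ν P π x * g (x (Fin.last H)) = ∑ s, occupancy ν P π (Fin.last H) s * g s := by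
  induction H generalizing g with
  | zero =>
    rw [← (Equiv.funUnique (Fin 1) X).symm.sum_comp]
    simp [pathProb]
  | succ H ih =>
    rw [sum_pathProb_mul_snoc]
    simp only [Fin.snoc_last]
    rw [ih (fun h => P h.castSucc) (fun h => π h.castSucc)
      (fun s => ∑ y, P (Fin.last H) s (π (Fin.last H) s) y * g y), ← occupancy_castSucc,
      ← Fin.succ_last, sum_occupancy_succ_mul]

theorem sum_pathProb_mul_step (ν : X → ℝ) (P : Fin H → X → A → X → ℝ)
    (hP : ∀ h s a, ∑ s', P h s a s' = 1) (π : Policy X A H) (h : Fin H) (g : X → X → ℝ) :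
    ∑ x, pathProb ν P π x * g (x h.castSucc) (x h.succ) =
      ∑ s, occupancy ν P π h.castSucc s * ∑ s', P h s (π h s) s' * g s s' := by
  induction H with
  | zero => exact h.elim0
  | succ H ih =>
    rw [sum_pathProb_mul_snoc]
    cases h using Fin.lastCases with
    | last =>
      simp only [Fin.snoc_castSucc, Fin.succ_last, Fin.snoc_last]
      rw [sum_pathProb_mul_last ν (fun h => P h.castSucc) (fun h => π h.castSucc)
        (fun s => ∑ s', P (Fin.last H) s (π (Fin.last H) s) s' * g s s'), occupancy_castSucc]
    | cast j =>
      simp only [Fin.snoc_castSucc, Fin.succ_castSucc, ← Finset.sum_mul, hP, one_mul]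
      rw [ih (fun h => P h.castSucc) (fun h => hP _) (fun h => π h.castSucc) j,
        occupancy_castSucc]

theorem sum_trajProb_mul_step [Fintype A] (ν : X → ℝ) (P : Fin H → X → A → X → ℝ)
    (hP : ∀ h s a, ∑ s', P h s a s' = 1) (π : Policy X A H) (h : Fin H) (g : X → A → X → ℝ) :
    ∑ τ, trajProb ν P π τ * g (τ.1 h.castSucc) (τ.2 h) (τ.1 h.succ) =
      ∑ s, occupancy ν P π h.castSucc s * ∑ s', P h s (π h s) s' * g s (π h s) s' := by
  rw [sum_trajProb_mul]
  exact sum_pathProb_mul_step ν P hP π h fun s s' => g s (π h s) s'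

theorem value_eq_sum_occupancy [Fintype A] (ν : X → ℝ) (P : Fin H → X → A → X → ℝ)
    (hP : ∀ h s a, ∑ s', P h s a s' = 1) (π : Policy X A H) (r : Fin H → X → A → ℝ) :
    value ν P π r = ∑ h, ∑ s, occupancy ν P π h.castSucc s * r h s (π h s) := by
  simp only [value, Finset.mul_sum]
  rw [Finset.sum_comm]
  refine Finset.sum_congr rfl fun h _ => ?_
  rw [sum_trajProb_mul_step ν P hP π h fun s a _ => r h s a]
  simp only [← Finset.sum_mul, hP, one_mul]

theorem sum_occupancy_succ {ν : X → ℝ} {P : Fin H → X → A → X → ℝ}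
    (hP : ∀ h s a, ∑ s', P h s a s' = 1) (π : Policy X A H) (h : Fin H) :
    ∑ s, occupancy ν P π h.succ s = ∑ s, occupancy ν P π h.castSucc s := by
  simpa [hP] using sum_occupancy_succ_mul ν P π h fun _ => 1

theorem sum_occupancy {ν : X → ℝ} {P : Fin H → X → A → X → ℝ}
    (hP : ∀ h s a, ∑ s', P h s a s' = 1) (π : Policy X A H) (i : Fin (H + 1)) :
    ∑ s, occupancy ν P π i s = ∑ s, ν s := by
  induction i using Fin.induction with
  | zero => rfl
  | succ h ih => rw [sum_occupancy_succ hP, ih]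

theorem occupancy_nonneg {ν : X → ℝ} {P : Fin H → X → A → X → ℝ} (hν : ∀ s, 0 ≤ ν s)
    (hP : ∀ h s a s', 0 ≤ P h s a s') (π : Policy X A H) (i : Fin (H + 1)) (s : X) :
    0 ≤ occupancy ν P π i s := by
  induction i using Fin.induction generalizing s with
  | zero => exact hν s
  | succ h ih => exact Finset.sum_nonneg fun u _ => mul_nonneg (ih u) (hP _ _ _ _)

section Comparison

variable {ν : X → ℝ} {P Q : Fin H → X → A → X → ℝ}

theorem occupancy_le_pow_mul {κ : ℝ} (hν : ∀ s, 0 ≤ ν s) (hP : ∀ h s a s', 0 ≤ P h s a s')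
    (hPQ : ∀ h s a s', P h s a s' ≤ κ * Q h s a s') (π : Policy X A H) (i : Fin (H + 1)) (s : X) :
    occupancy ν P π i s ≤ κ ^ (i : ℕ) * occupancy ν Q π i s := by
  induction i using Fin.induction generalizing s with
  | zero => simp
  | succ h ih =>
    rw [occupancy_succ, occupancy_succ, Finset.mul_sum]
    refine Finset.sum_le_sum fun u _ => ?_
    calc occupancy ν P π h.castSucc u * P h u (π h u) s
        ≤ (κ ^ (h : ℕ) * occupancy ν Q π h.castSucc u) * (κ * Q h u (π h u) s) :=
          mul_le_mul (ih u) (hPQ _ _ _ _) (hP _ _ _ _)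
            ((occupancy_nonneg hν hP π _ u).trans (ih u))
      _ = κ ^ (h.succ : ℕ) * (occupancy ν Q π h.castSucc u * Q h u (π h u) s) := by
          rw [Fin.val_succ]; ring

theorem occupancy_mono (hν : ∀ s, 0 ≤ ν s) (hP : ∀ h s a s', 0 ≤ P h s a s')
    (hPQ : ∀ h s a s', P h s a s' ≤ Q h s a s') (π : Policy X A H) (i : Fin (H + 1)) (s : X) :
    occupancy ν P π i s ≤ occupancy ν Q π i s := by
  simpa using occupancy_le_pow_mul (κ := 1) hν hP (by simpa using hPQ) π i s

theorem one_add_div_pow_le_exp {c : ℝ} (hc : 0 ≤ c) {i n : ℕ} (hi : i ≤ n) :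
    (1 + c / n) ^ i ≤ Real.exp c := by
  calc (1 + c / n) ^ i ≤ (1 + c / n) ^ n :=
        pow_le_pow_right₀ (le_add_of_nonneg_right (by positivity)) hi
    _ ≤ Real.exp c := by
        simpa [neg_div] using Real.one_sub_div_pow_le_exp_neg (n := n) (t := -c)
          (by linarith [n.cast_nonneg (α := ℝ)])

theorem occupancy_le_exp_mul {c : ℝ} (hc : 0 ≤ c) (hν : ∀ s, 0 ≤ ν s)
    (hP : ∀ h s a s', 0 ≤ P h s a s') (hPQ : ∀ h s a s', P h s a s' ≤ (1 + c / H) * Q h s a s')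
    (π : Policy X A H) (i : Fin (H + 1)) (s : X) :
    occupancy ν P π i s ≤ Real.exp c * occupancy ν Q π i s := by
  have hQ : ∀ h s a s', 0 ≤ Q h s a s' := fun h s a s' =>
    nonneg_of_mul_nonneg_right ((hP h s a s').trans (hPQ h s a s')) (by positivity)
  exact (occupancy_le_pow_mul hν hP hPQ π i s).trans <|
    mul_le_mul_of_nonneg_right (one_add_div_pow_le_exp hc i.is_le) (occupancy_nonneg hν hQ π i s)

theorem sum_occupancy_sub_le (hP : ∀ h s a, ∑ s', P h s a s' = 1) {π : Policy X A H} {L : ℝ}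
    (hL : ∀ h : Fin H, ∑ s, ∑ s',
      occupancy ν Q π h.castSucc s * (P h s (π h s) s' - Q h s (π h s) s') ≤ L)
    (i : Fin (H + 1)) :
    ∑ s, (occupancy ν P π i s - occupancy ν Q π i s) ≤ i * L := by
  induction i using Fin.induction with
  | zero => simp
  | succ h ih =>
    have hloss := hL h
    have hQ : ∑ s, occupancy ν Q π h.succ s =
        ∑ s, ∑ s', occupancy ν Q π h.castSucc s * Q h s (π h s) s' := by
      simpa [Finset.mul_sum] using sum_occupancy_succ_mul ν Q π h fun _ => 1
    simp only [mul_sub, Finset.sum_sub_distrib, ← Finset.mul_sum, hP, mul_one, Fin.val_castSucc]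
      at hloss ih hQ
    rw [Finset.sum_sub_distrib, sum_occupancy_succ hP, hQ, Fin.val_succ]
    push_cast
    linarith

end Comparison

open Classical in
/-- The probability of visiting the state-action pair `(s, a)` at step `h`. -/
noncomputable def visitProb (ν : X → ℝ) (P : Fin H → X → A → X → ℝ) (π : Policy X A H) (h : Fin H)
    (s : X) (a : A) : ℝ :=
  if π h s = a then occupancy ν P π h.castSucc s else 0

@[simp]
theorem visitProb_self (ν : X → ℝ) (P : Fin H → X → A → X → ℝ) (π : Policy X A H) (h : Fin H)
    (s : X) : visitProb ν P π h s (π h s) = occupancy ν P π h.castSucc s :=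
  if_pos rfl

section Coverage

variable {ν : X → ℝ} {P Q : Fin H → X → A → X → ℝ}

theorem visitProb_mono (hν : ∀ s, 0 ≤ ν s) (hP : ∀ h s a s', 0 ≤ P h s a s')
    (hPQ : ∀ h s a s', P h s a s' ≤ Q h s a s') (π : Policy X A H) (h : Fin H) (s : X) (a : A) :
    visitProb ν P π h s a ≤ visitProb ν Q π h s a := by
  simp only [visitProb]
  split_ifs
  · exact occupancy_mono hν hP hPQ π _ s
  · exact le_rfl

theorem visitProb_le_exp_mul {c : ℝ} (hc : 0 ≤ c) (hν : ∀ s, 0 ≤ ν s)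
    (hP : ∀ h s a s', 0 ≤ P h s a s') (hPQ : ∀ h s a s', P h s a s' ≤ (1 + c / H) * Q h s a s')
    (π : Policy X A H) (h : Fin H) (s : X) (a : A) :
    visitProb ν P π h s a ≤ Real.exp c * visitProb ν Q π h s a := by
  simp only [visitProb]
  split_ifs
  · exact occupancy_le_exp_mul hc hν hP hPQ π _ s
  · simp

theorem visitProb_le_exp_mul_of_visitProb_le {c : ℝ} (hc : 0 ≤ c) (hν : ∀ s, 0 ≤ ν s)
    (hP : ∀ h s a s', 0 ≤ P h s a s') (hQ : ∀ h s a s', 0 ≤ Q h s a s')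
    (hPQ : ∀ h s a s', P h s a s' ≤ (1 + c / H) * Q h s a s')
    (hQP : ∀ h s a s', Q h s a s' ≤ (1 + c / H) * P h s a s')
    {π σ : Policy X A H} {h : Fin H} {s : X} {a : A}
    (hπσ : visitProb ν Q π h s a ≤ visitProb ν Q σ h s a) :
    visitProb ν P π h s a ≤ Real.exp (2 * c) * visitProb ν P σ h s a := by
  calc visitProb ν P π h s a
      ≤ Real.exp c * visitProb ν Q π h s a := visitProb_le_exp_mul hc hν hP hPQ π h s a
    _ ≤ Real.exp c * visitProb ν Q σ h s a := by gcongr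
    _ ≤ Real.exp c * (Real.exp c * visitProb ν P σ h s a) := by
        gcongr
        exact visitProb_le_exp_mul hc hν hQ hQP σ h s a
    _ = Real.exp (2 * c) * visitProb ν P σ h s a := by rw [← mul_assoc, ← Real.exp_add, two_mul]

end Coverage

end Occupancy

section AbsorbingState

variable {S A : Type*} [Fintype S] {H : ℕ}

/-- The restriction to `S` of a kernel on `Option S`: it is substochastic, the mass moving to the
absorbing state `none` being lost. -/
def restrictSome (Q : Fin H → Option S → A → Option S → ℝ) : Fin H → S → A → S → ℝ :=
  fun h s a s' => Q h (some s) a (some s')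

open Classical in
theorem restrictSome_absorbingKernel (P : Fin H → S → A → S → ℝ) (F : Set (Fin H × S × A × S))
    (h : Fin H) (s : S) (a : A) (s' : S) :
    restrictSome (absorbingKernel P F) h s a s' = if (h, s, a, s') ∈ F then 0 else P h s a s' :=
  rfl

open Classical in
theorem restrictSome_crudeKernel (n2 : Fin H → S → A → ℝ) (n3 : Fin H → S → A → S → ℝ)
    (F : Set (Fin H × S × A × S)) (h : Fin H) (s : S) (a : A) (s' : S) :
    restrictSome (crudeKernel n2 n3 F) h s a s' =
      if (h, s, a, s') ∈ F then 0 else n3 h s a s' / n2 h s a :=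
  rfl

theorem restrictSome_absorbingKernel_nonneg {P : Fin H → S → A → S → ℝ}
    (hP : ∀ h s a s', 0 ≤ P h s a s') (F : Set (Fin H × S × A × S)) (h : Fin H) (s : S) (a : A)
    (s' : S) : 0 ≤ restrictSome (absorbingKernel P F) h s a s' := by
  rw [restrictSome_absorbingKernel]
  split_ifs
  exacts [le_rfl, hP h s a s']

theorem restrictSome_absorbingKernel_le {P : Fin H → S → A → S → ℝ}
    (hP : ∀ h s a s', 0 ≤ P h s a s') (F : Set (Fin H × S × A × S)) (h : Fin H) (s : S) (a : A)
    (s' : S) : restrictSome (absorbingKernel P F) h s a s' ≤ P h s a s' := by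
  rw [restrictSome_absorbingKernel]
  split_ifs
  exacts [hP h s a s', le_rfl]

theorem sum_absorbingKernel {P : Fin H → S → A → S → ℝ} (hP : ∀ h s a, ∑ s', P h s a s' = 1)
    (F : Set (Fin H × S × A × S)) (h : Fin H) (x : Option S) (a : A) :
    ∑ y, absorbingKernel P F h x a y = 1 := by
  rw [Fintype.sum_option]
  cases x with
  | none => simp [absorbingKernel]
  | some s =>
    simp only [absorbingKernel]
    rw [← Finset.sum_add_distrib, ← hP h s a]
    refine Finset.sum_congr rfl fun s' _ => ?_
    split_ifs <;> simp

theorem sum_crudeKernel (n2 : Fin H → S → A → ℝ) (n3 : Fin H → S → A → S → ℝ)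
    (F : Set (Fin H × S × A × S)) (h : Fin H) (x : Option S) (a : A) :
    ∑ y, crudeKernel n2 n3 F h x a y = 1 := by
  rw [Fintype.sum_option]
  cases x <;> simp [crudeKernel]

variable [Nonempty A]

theorem occupancy_some (ν : S → ℝ) {Q : Fin H → Option S → A → Option S → ℝ}
    (hQ : ∀ h a s, Q h none a (some s) = 0) (π : Policy S A H) (i : Fin (H + 1)) (s : S) :
    occupancy (fun x => x.elim 0 ν) Q (fun h x => x.elim (Classical.arbitrary A) (π h)) i
      (some s) = occupancy ν (restrictSome Q) π i s := by
  induction i using Fin.induction generalizing s with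
  | zero => rfl
  | succ h ih => simp [occupancy_succ, Fintype.sum_option, hQ, ih, restrictSome]

theorem valueExt_eq_sum_occupancy [Fintype A] (ν : S → ℝ)
    {Q : Fin H → Option S → A → Option S → ℝ} (hQ : ∀ h x a, ∑ y, Q h x a y = 1)
    (hQnone : ∀ h a s, Q h none a (some s) = 0) (π : Policy S A H) (r : Fin H → S → A → ℝ) :
    valueExt ν Q π r =
      ∑ h, ∑ s, occupancy ν (restrictSome Q) π h.castSucc s * r h s (π h s) := by
  simp [valueExt, value_eq_sum_occupancy _ _ hQ, Fintype.sum_option, occupancy_some _ hQnone]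

theorem valueExt_indicatorReward [Fintype A] (ν : S → ℝ)
    {Q : Fin H → Option S → A → Option S → ℝ} (hQ : ∀ h x a, ∑ y, Q h x a y = 1)
    (hQnone : ∀ h a s, Q h none a (some s) = 0) (π : Policy S A H) (h : Fin H) (s : S) (a : A) :
    valueExt ν Q π (indicatorReward h s a) = visitProb ν (restrictSome Q) π h s a := by
  rw [valueExt_eq_sum_occupancy ν hQ hQnone, Fintype.sum_eq_single h, Fintype.sum_eq_single s]
  · by_cases ha : π h s = a <;> simp [indicatorReward, visitProb, ha]
  · intro u hu; simp [indicatorReward, hu]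
  · intro j hj; simp [indicatorReward, hj]

end AbsorbingState

section FiniteRange

variable {Ω β F : Type*} [MeasurableSpace Ω] {μ : Measure Ω} [IsFiniteMeasure μ]
  [NormedAddCommGroup F] {Y : Ω → β}

theorem integrable_comp_of_measurableSet_fiber [Finite β]
    (hY : ∀ y, MeasurableSet {ω | Y ω = y}) (f : β → F) : Integrable (fun ω => f (Y ω)) μ := by
  let _ : MeasurableSpace β := ⊤
  exact (Integrable.of_finite (f := f)).comp_measurable (measurable_to_countable' hY)

theorem integral_comp_eq_sum_fiber [Fintype β] [NormedSpace ℝ F] [CompleteSpace F]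
    (hY : ∀ y, MeasurableSet {ω | Y ω = y}) (f : β → F) :
    ∫ ω, f (Y ω) ∂μ = ∑ y, μ.real {ω | Y ω = y} • f y := by
  let _ : MeasurableSpace β := ⊤
  have hY' : Measurable Y := measurable_to_countable' hY
  have hf : Integrable f (μ.map Y) := Integrable.of_finite
  rw [← integral_map hY'.aemeasurable hf.aestronglyMeasurable, integral_fintype hf]
  refine Finset.sum_congr rfl fun y _ => ?_
  rw [map_measureReal_apply hY' (MeasurableSet.singleton y)]
  rfl

end FiniteRange

section ExponentialMoments

variable {X : Type*} [Fintype X]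

theorem sum_prod_mul_exp_sum (w g : X → ℝ) (n : ℕ) :
    ∑ d : Fin n → X, (∏ i, w (d i)) * Real.exp (∑ i, g (d i)) =
      (∑ x, w x * Real.exp (g x)) ^ n := by
  simp only [Fintype.sum_pow, Real.exp_sum, Finset.prod_mul_distrib]

theorem sum_mul_exp_indicator {w : X → ℝ} (hw : ∑ x, w x = 1) (Y : X → Prop) [DecidablePred Y]
    (t : ℝ) :
    ∑ x, w x * Real.exp (t * if Y x then 1 else 0) =
      1 + (Real.exp t - 1) * ∑ x, w x * if Y x then 1 else 0 := by
  have hsplit (x : X) : w x * Real.exp (t * if Y x then 1 else 0) =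
      w x + (Real.exp t - 1) * (w x * if Y x then 1 else 0) := by
    split_ifs
    · rw [mul_one, mul_one]; ring
    · simp
  simp only [hsplit, Finset.sum_add_distrib, hw, ← Finset.mul_sum]

theorem sum_mul_exp_indicator_sub_le_one {w : X → ℝ} (hw : ∑ x, w x = 1) (Y : X → Prop)
    [DecidablePred Y] (t : ℝ) :
    ∑ x, w x * Real.exp ((t * if Y x then 1 else 0) -
      (Real.exp t - 1) * ∑ y, w y * if Y y then 1 else 0) ≤ 1 := by
  set c := (Real.exp t - 1) * ∑ y, w y * if Y y then 1 else 0
  simp only [Real.exp_sub, ← mul_div_assoc]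
  rw [← Finset.sum_div, sum_mul_exp_indicator hw Y, div_le_one (Real.exp_pos c), add_comm]
  exact Real.add_one_le_exp c

end ExponentialMoments

namespace EpisodicMDP

variable {S A : Type*} [Fintype S] {H : ℕ} (M : EpisodicMDP S A H)

include M in
theorem nonempty_state : Nonempty S := by
  by_contra h
  rw [not_nonempty_iff] at h
  simpa using M.init_sum

theorem trans_le_one (h : Fin H) (s : S) (a : A) (s' : S) : M.trans h s a s' ≤ 1 :=
  M.trans_sum h s a ▸
    Finset.single_le_sum (fun u _ => M.trans_nonneg h s a u) (Finset.mem_univ s')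

theorem occupancy_nonneg (π : Policy S A H) (i : Fin (H + 1)) (s : S) :
    0 ≤ occupancy M.init M.trans π i s :=
  PrivateRL.occupancy_nonneg M.init_nonneg M.trans_nonneg π i s

theorem sum_occupancy (π : Policy S A H) (i : Fin (H + 1)) :
    ∑ s, occupancy M.init M.trans π i s = 1 :=
  (PrivateRL.sum_occupancy M.trans_sum π i).trans M.init_sum

theorem occupancy_le_one (π : Policy S A H) (i : Fin (H + 1)) (s : S) :
    occupancy M.init M.trans π i s ≤ 1 :=
  M.sum_occupancy π i ▸
    Finset.single_le_sum (fun u _ => M.occupancy_nonneg π i u) (Finset.mem_univ s)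

theorem trajProb_nonneg (π : Policy S A H) (τ : Traj S A H) :
    0 ≤ trajProb M.init M.trans π τ := by
  refine mul_nonneg (M.init_nonneg _) (Finset.prod_nonneg fun h _ => ?_)
  split_ifs
  exacts [M.trans_nonneg _ _ _ _, le_rfl]

theorem sum_trajProb [Fintype A] (π : Policy S A H) : ∑ τ, trajProb M.init M.trans π τ = 1 := by
  simpa [M.sum_occupancy π (Fin.last H)] using
    (sum_trajProb_mul M.init M.trans π fun _ => 1).trans
      (sum_pathProb_mul_last M.init M.trans π fun _ => 1)

open Classical in
theorem sum_trajProb_mul_indicator [Fintype A] (π : Policy S A H) (h : Fin H) (s : S) (a : A)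
    (s' : S) :
    (∑ τ : Traj S A H, trajProb M.init M.trans π τ *
      if τ.1 h.castSucc = s ∧ τ.2 h = a ∧ τ.1 h.succ = s' then 1 else 0) =
      visitProb M.init M.trans π h s a * M.trans h s a s' := by
  rw [sum_trajProb_mul_step M.init M.trans M.trans_sum π h
    (fun u b v => if u = s ∧ b = a ∧ v = s' then 1 else 0), Fintype.sum_eq_single s]
  · by_cases ha : π h s = a <;> simp [visitProb, ha]
  · intro u hu; simp [hu]

open Classical in
theorem sum_trajProb_mul_exp_le_one [Fintype A] (π : Policy S A H) (h : Fin H) (s : S) (a : A)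
    (s' : S) (t : ℝ) :
    ∑ τ : Traj S A H, trajProb M.init M.trans π τ * Real.exp (
      (t * if τ.1 h.castSucc = s ∧ τ.2 h = a ∧ τ.1 h.succ = s' then 1 else 0) -
      (Real.exp t - 1) * M.trans h s a s' *
        if τ.1 h.castSucc = s ∧ τ.2 h = a then 1 else 0) ≤ 1 := by
  rw [sum_trajProb_mul_step M.init M.trans M.trans_sum π h (fun u b v => Real.exp (
      (t * if u = s ∧ b = a ∧ v = s' then 1 else 0) -
      (Real.exp t - 1) * M.trans h s a s' * if u = s ∧ b = a then 1 else 0))]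
  refine (Finset.sum_le_sum fun u _ => mul_le_of_le_one_right (M.occupancy_nonneg _ _ _)
    ?_).trans_eq (M.sum_occupancy π h.castSucc)
  by_cases hu : u = s ∧ π h u = a
  · obtain ⟨rfl, rfl⟩ := hu
    simpa using sum_mul_exp_indicator_sub_le_one (M.trans_sum h u (π h u)) (· = s') t
  · simp [hu, ← and_assoc, M.trans_sum]

end EpisodicMDP

section Mixture

variable {S A : Type*} [Fintype S] [Fintype A] {H : ℕ} (M : EpisodicMDP S A H)
  (pol : S → A → Policy S A H)

theorem mixtureProb_nonneg (τ : Traj S A H) : 0 ≤ mixtureProb M pol τ :=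
  mul_nonneg (by positivity)
    (Finset.sum_nonneg fun _ _ => Finset.sum_nonneg fun _ _ => M.trajProb_nonneg _ _)

theorem sum_mixtureProb_mul (f : Traj S A H → ℝ) :
    ∑ τ, mixtureProb M pol τ * f τ =
      1 / ((Fintype.card S : ℝ) * (Fintype.card A : ℝ)) *
        ∑ s, ∑ a, ∑ τ, trajProb M.init M.trans (pol s a) τ * f τ := by
  simp only [mixtureProb, mul_assoc, ← Finset.mul_sum, Finset.sum_mul]
  congr 1
  rw [Finset.sum_comm]
  exact Finset.sum_congr rfl fun s _ => Finset.sum_comm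

open Classical in
/-- The probability that an episode of the mixture makes the transition from `(s, a)` to `s'` at
step `h`. -/
noncomputable def mixtureTransition (h : Fin H) (s : S) (a : A) (s' : S) : ℝ :=
  ∑ τ : Traj S A H, mixtureProb M pol τ *
    if τ.1 h.castSucc = s ∧ τ.2 h = a ∧ τ.1 h.succ = s' then 1 else 0

theorem mixtureTransition_nonneg (h : Fin H) (s : S) (a : A) (s' : S) :
    0 ≤ mixtureTransition M pol h s a s' :=
  Finset.sum_nonneg fun τ _ => mul_nonneg (mixtureProb_nonneg M pol τ) (by positivity)

variable [Nonempty A]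

include M in
theorem card_state_mul_card_action_pos : (0 : ℝ) < Fintype.card S * Fintype.card A := by
  have := M.nonempty_state
  exact mul_pos (Nat.cast_pos.2 Fintype.card_pos) (Nat.cast_pos.2 Fintype.card_pos)

theorem sum_mixtureProb_mul_le {f : Traj S A H → ℝ} {b : ℝ}
    (hf : ∀ s a, ∑ τ, trajProb M.init M.trans (pol s a) τ * f τ ≤ b) :
    ∑ τ, mixtureProb M pol τ * f τ ≤ b := by
  rw [sum_mixtureProb_mul, one_div_mul_eq_div, div_le_iff₀' (card_state_mul_card_action_pos M)]
  refine (Finset.sum_le_sum fun s _ => Finset.sum_le_sum fun a _ => hf s a).trans_eq ?_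
  simp [mul_assoc]

theorem sum_mixtureProb : ∑ τ, mixtureProb M pol τ = 1 := by
  have h := sum_mixtureProb_mul M pol fun _ => 1
  simp only [mul_one, M.sum_trajProb, Finset.sum_const, Finset.card_univ, nsmul_eq_mul] at h
  rw [h, one_div_mul_cancel (card_state_mul_card_action_pos M).ne']

theorem visitProb_mul_trans_le_mixtureTransition (h : Fin H) (s : S) (a : A) (s' : S) :
    visitProb M.init M.trans (pol s a) h s a * M.trans h s a s' ≤
      Fintype.card S * Fintype.card A * mixtureTransition M pol h s a s' := by
  classical
  have hnonneg : ∀ t b, 0 ≤ ∑ τ : Traj S A H, trajProb M.init M.trans (pol t b) τ *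
      if τ.1 h.castSucc = s ∧ τ.2 h = a ∧ τ.1 h.succ = s' then 1 else 0 := fun t b =>
    Finset.sum_nonneg fun τ _ => mul_nonneg (M.trajProb_nonneg _ _) (by positivity)
  rw [mixtureTransition, sum_mixtureProb_mul, ← M.sum_trajProb_mul_indicator, ← mul_assoc,
    mul_one_div_cancel (card_state_mul_card_action_pos M).ne', one_mul]
  exact (Finset.single_le_sum (fun b _ => hnonneg s b) (Finset.mem_univ a)).trans
    (Finset.single_le_sum (fun t _ => Finset.sum_nonneg fun b _ => hnonneg t b)
      (Finset.mem_univ s))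

end Mixture

section Counts

variable {S A : Type*} {H n : ℕ} (D : Fin n → Traj S A H) (h : Fin H) (s : S) (a : A) (s' : S)

open Classical in
theorem visits_eq_sum :
    (visits D h s a : ℝ) = ∑ i, if (D i).1 h.castSucc = s ∧ (D i).2 h = a then 1 else 0 := by
  rw [Finset.sum_boole]
  rfl

open Classical in
theorem visitsNext_eq_sum :
    (visitsNext D h s a s' : ℝ) =
      ∑ i, if (D i).1 h.castSucc = s ∧ (D i).2 h = a ∧ (D i).1 h.succ = s' then 1 else 0 := by
  rw [Finset.sum_boole]
  rfl

theorem visitsNext_le_visits : visitsNext D h s a s' ≤ visits D h s a := by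
  classical
  unfold visitsNext visits
  exact Finset.card_le_card (Finset.monotone_filter_right _ fun _ _ hi => ⟨hi.1, hi.2.1⟩)

end Counts

/-- The counts of the tuple `(h, s, a, s')` in the dataset `D` deviate by less than `x` (on an
exponential scale with rate `θ`) from what is expected of episodes of the mixture of `pol`: the
transition count is compared with the visit count times the transition probability in both
directions, and bounded below by its expectation. -/
structure Concentrated {S A : Type*} [Fintype S] [Fintype A] {H n : ℕ} (M : EpisodicMDP S A H)
    (θ x : ℝ) (h : Fin H) (s : S) (a : A) (s' : S) (pol : S → A → Policy S A H)
    (D : Fin n → Traj S A H) : Prop where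
  upper : θ * visitsNext D h s a s' < (Real.exp θ - 1) * M.trans h s a s' * visits D h s a + x
  lower : (1 - Real.exp (-θ)) * M.trans h s a s' * visits D h s a <
    θ * visitsNext D h s a s' + x
  mixture : (1 - Real.exp (-1)) * (n * mixtureTransition M pol h s a s') <
    visitsNext D h s a s' + x

namespace Run

variable {S A Ω : Type*} [Fintype S] [Fintype A] [Nonempty A] {H : ℕ}
  {M : EpisodicMDP S A H} [mΩ : MeasurableSpace Ω] {μ : Measure Ω}
  {K : ℕ} {len : Fin K → ℕ} {E ι : ℝ} (R : Run M μ len E ι) (k : Fin K) (h : Fin H)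

theorem measurableSet_pol_eq (p : S → A → Policy S A H) : MeasurableSet {ω | R.pol k h ω = p} :=
  R.hist.le _ _ (R.pol_measurable k h p)

theorem measurableSet_pol_data_eq
    (y : (S → A → Policy S A H) × (Fin (len k / H) → Traj S A H)) :
    MeasurableSet {ω | (R.pol k h ω, R.data k h ω) = y} := by
  simp only [Prod.ext_iff]
  exact (R.measurableSet_pol_eq k h y.1).inter (R.hist.le _ _ (R.data_measurable k h y.2))

variable [IsProbabilityMeasure μ]

theorem measureReal_pol_inter_data (p : S → A → Policy S A H)
    (d : Fin (len k / H) → Traj S A H) :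
    μ.real ({ω | R.pol k h ω = p} ∩ {ω | R.data k h ω = d}) =
      μ.real {ω | R.pol k h ω = p} * ∏ i, mixtureProb M p (d i) := by
  have hle : R.hist ((k : ℕ) * H + h) ≤ mΩ := R.hist.le _
  have hpol := R.pol_measurable k h p
  have hdata : MeasurableSet {ω | R.data k h ω = d} := R.hist.le _ _ (R.data_measurable k h d)
  have hcond := setIntegral_condExp hle ((integrable_const (μ := μ) (1 : ℝ)).indicator hdata) hpol
  rw [setIntegral_indicator hdata, setIntegral_const, smul_eq_mul, mul_one] at hcond
  rw [← hcond, setIntegral_congr_ae (g := fun _ => ∏ i, mixtureProb M p (d i)) (hle _ hpol),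
    setIntegral_const, smul_eq_mul]
  filter_upwards [R.data_law k h d] with ω hω hωp
  rw [hω, show R.pol k h ω = p from hωp]

open Classical in
theorem integral_pol_data
    (f : (S → A → Policy S A H) → (Fin (len k / H) → Traj S A H) → ℝ) :
    ∫ ω, f (R.pol k h ω) (R.data k h ω) ∂μ =
      ∑ p, μ.real {ω | R.pol k h ω = p} * ∑ d, (∏ i, mixtureProb M p (d i)) * f p d := by
  rw [integral_comp_eq_sum_fiber (R.measurableSet_pol_data_eq k h) fun y => f y.1 y.2,
    Fintype.sum_prod_type]
  refine Finset.sum_congr rfl fun p _ => ?_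
  rw [Finset.mul_sum]
  refine Finset.sum_congr rfl fun d _ => ?_
  simp only [Prod.mk.injEq, Set.ofPred_and, measureReal_pol_inter_data, smul_eq_mul, mul_assoc]

open Classical in
theorem sum_measureReal_pol : ∑ p, μ.real {ω | R.pol k h ω = p} = 1 := by
  simpa using
    (integral_comp_eq_sum_fiber (μ := μ) (R.measurableSet_pol_eq k h) fun _ => (1 : ℝ)).symm

theorem mgf_sum_data_le_one {g : (S → A → Policy S A H) → Traj S A H → ℝ}
    (hg : ∀ p, ∑ τ, mixtureProb M p τ * Real.exp (g p τ) ≤ 1) :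
    mgf (fun ω => ∑ i, g (R.pol k h ω) (R.data k h ω i)) μ 1 ≤ 1 := by
  classical
  have hnonneg : ∀ p, 0 ≤ ∑ τ, mixtureProb M p τ * Real.exp (g p τ) := fun p =>
    Finset.sum_nonneg fun τ _ => mul_nonneg (mixtureProb_nonneg M p τ) (Real.exp_pos _).le
  simp only [mgf, one_mul]
  rw [R.integral_pol_data k h fun p d => Real.exp (∑ i, g p (d i)),
    ← R.sum_measureReal_pol k h]
  refine Finset.sum_le_sum fun p _ => mul_le_of_le_one_right measureReal_nonneg ?_
  rw [sum_prod_mul_exp_sum]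
  exact pow_le_one₀ (hnonneg p) (hg p)

theorem measureReal_le_sum_data_le_exp_neg {g : (S → A → Policy S A H) → Traj S A H → ℝ}
    (hg : ∀ p, ∑ τ, mixtureProb M p τ * Real.exp (g p τ) ≤ 1) (x : ℝ) :
    μ.real {ω | x ≤ ∑ i, g (R.pol k h ω) (R.data k h ω i)} ≤ Real.exp (-x) := by
  have hint : Integrable (fun ω => Real.exp (1 * ∑ i, g (R.pol k h ω) (R.data k h ω i))) μ :=
    integrable_comp_of_measurableSet_fiber (R.measurableSet_pol_data_eq k h)
      fun y => Real.exp (1 * ∑ i, g y.1 (y.2 i))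
  calc μ.real {ω | x ≤ ∑ i, g (R.pol k h ω) (R.data k h ω i)}
      ≤ Real.exp (-1 * x) * mgf (fun ω => ∑ i, g (R.pol k h ω) (R.data k h ω i)) μ 1 :=
        measure_ge_le_exp_mul_mgf x zero_le_one hint
    _ ≤ Real.exp (-1 * x) :=
        mul_le_of_le_one_right (Real.exp_pos _).le (R.mgf_sum_data_le_one k h hg)
    _ = Real.exp (-x) := by rw [neg_one_mul]

variable (s : S) (a : A) (s' : S)

theorem measureReal_le_visitsNext_sub_visits_le (t x : ℝ) :
    μ.real {ω | x ≤ t * visitsNext (R.data k h ω) h s a s' -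
      (Real.exp t - 1) * M.trans h s a s' * visits (R.data k h ω) h s a} ≤ Real.exp (-x) := by
  simp only [visits_eq_sum, visitsNext_eq_sum, Finset.mul_sum, ← Finset.sum_sub_distrib]
  exact R.measureReal_le_sum_data_le_exp_neg k h
    (fun p => sum_mixtureProb_mul_le M p fun _ _ => M.sum_trajProb_mul_exp_le_one _ h s a s' t) x

theorem measureReal_le_visitsNext_sub_mixtureTransition_le (t x : ℝ) :
    μ.real {ω | x ≤ t * visitsNext (R.data k h ω) h s a s' -
      (len k / H : ℕ) * ((Real.exp t - 1) * mixtureTransition M (R.pol k h ω) h s a s')} ≤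
      Real.exp (-x) := by
  classical
  have hcount (ω : Ω) : t * visitsNext (R.data k h ω) h s a s' -
      (len k / H : ℕ) * ((Real.exp t - 1) * mixtureTransition M (R.pol k h ω) h s a s') =
      ∑ i, ((t * if (R.data k h ω i).1 h.castSucc = s ∧ (R.data k h ω i).2 h = a ∧
          (R.data k h ω i).1 h.succ = s' then 1 else 0) -
        (Real.exp t - 1) * mixtureTransition M (R.pol k h ω) h s a s') := by
    rw [visitsNext_eq_sum, Finset.sum_sub_distrib, Finset.mul_sum]
    simp
  simp only [hcount]
  exact R.measureReal_le_sum_data_le_exp_neg k h (fun p => sum_mul_exp_indicator_sub_le_one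
    (sum_mixtureProb M p) (fun τ : Traj S A H =>
      τ.1 h.castSucc = s ∧ τ.2 h = a ∧ τ.1 h.succ = s') t) x

theorem measureReal_not_concentrated_le (θ x : ℝ) :
    μ.real {ω | ¬ Concentrated M θ x h s a s' (R.pol k h ω) (R.data k h ω)} ≤
      3 * Real.exp (-x) := by
  have hupper := R.measureReal_le_visitsNext_sub_visits_le k h s a s' θ x
  have hlower := R.measureReal_le_visitsNext_sub_visits_le k h s a s' (-θ) x
  have hmixture := R.measureReal_le_visitsNext_sub_mixtureTransition_le k h s a s' (-1) x
  refine (measureReal_mono fun ω hω => ?_).trans <| (measureReal_union_le _ _).trans <|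
    (add_le_add ((measureReal_union_le _ _).trans (add_le_add hupper hlower)) hmixture).trans_eq
      (by ring)
  by_contra hgood
  simp only [Set.mem_union, Set.mem_ofPred_eq, not_or, not_le] at hgood
  obtain ⟨⟨hup, hlow⟩, hmix⟩ := hgood
  exact hω ⟨by linarith, by linarith, by linarith⟩

theorem measureReal_not_forall_concentrated_le (θ x : ℝ) :
    μ.real {ω | ¬ ∀ k h s a s', Concentrated M θ x h s a s' (R.pol k h ω) (R.data k h ω)} ≤
      3 * (K * H * Fintype.card S ^ 2 * Fintype.card A) * Real.exp (-x) := by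
  have hunion : {ω | ¬ ∀ k h s a s',
        Concentrated M θ x h s a s' (R.pol k h ω) (R.data k h ω)} =
      ⋃ y : Fin K × Fin H × S × A × S, {ω | ¬ Concentrated M θ x y.2.1 y.2.2.1 y.2.2.2.1
        y.2.2.2.2 (R.pol y.1 y.2.1 ω) (R.data y.1 y.2.1 ω)} := by
    ext ω
    simp only [not_forall, Set.mem_ofPred_eq, Set.mem_iUnion, Prod.exists]
  rw [hunion]
  refine (measureReal_iUnion_fintype_le _).trans <|
    (Finset.sum_le_sum fun y _ => R.measureReal_not_concentrated_le _ _ _ _ _ θ x).trans_eq ?_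
  simp only [Finset.sum_const, Finset.card_univ, Fintype.card_prod, Fintype.card_fin,
    nsmul_eq_mul, Nat.cast_mul]
  ring

end Run

section Scalar

variable {θ p N₂ N₃ n₂ n₃ : ℝ}

theorem exp_sub_one_le_mul_one_add (hθ : 0 ≤ θ) (hθ1 : θ ≤ 1) :
    Real.exp θ - 1 ≤ θ * (1 + θ) := by
  have h := Real.abs_exp_sub_one_sub_id_le (x := θ) (by rwa [abs_of_nonneg hθ])
  linarith [(abs_le.1 h).2]

theorem le_one_add_mul_one_sub_exp_neg (θ : ℝ) : θ ≤ (1 + θ) * (1 - Real.exp (-θ)) := by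
  have h := mul_le_mul_of_nonneg_right (Real.add_one_le_exp θ) (Real.exp_pos (-θ)).le
  rw [← Real.exp_add, add_neg_cancel, Real.exp_zero] at h
  linarith

theorem div_le_one_add_mul_of_count_le (hθ : 0 < θ) (hθ1 : θ ≤ 1) (hp : 0 ≤ p) (hn₂ : 0 < n₂)
    (hn₃ : 0 ≤ n₃) (h₂ : N₂ ≤ n₂) (h₃ : n₃ ≤ N₃ + θ * n₃ / 3)
    (hN : N₃ ≤ (1 + θ) * (p * N₂) + θ * n₃ / 3) :
    n₃ / n₂ ≤ (1 + 5 * θ) * p := by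
  have hpn : 0 ≤ p * n₂ := by positivity
  have hp₂ : (1 + θ) * (p * N₂) ≤ (1 + θ) * (p * n₂) := by gcongr
  rw [div_le_iff₀ hn₂, mul_assoc]
  calc n₃ ≤ (1 + 2 * θ) * (n₃ * (1 - 2 * θ / 3)) := by
        nlinarith [mul_nonneg (mul_nonneg hθ.le hn₃) (sub_nonneg.2 hθ1)]
    _ ≤ (1 + 2 * θ) * ((1 + θ) * (p * n₂)) :=
        mul_le_mul_of_nonneg_left (by linarith) (by linarith)
    _ = (1 + 3 * θ + 2 * θ ^ 2) * (p * n₂) := by ring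
    _ ≤ (1 + 5 * θ) * (p * n₂) := mul_le_mul_of_nonneg_right (by nlinarith) hpn

theorem le_one_add_mul_div_of_le_count (hθ : 0 < θ) (hθ1 : θ ≤ 1) (hp : 0 ≤ p) (hp1 : p ≤ 1)
    (hn₂ : 0 < n₂) (hn₃ : 0 ≤ n₃) (h₂ : n₂ ≤ N₂ + θ * n₃ / 3) (h₃ : N₃ ≤ n₃ + θ * n₃ / 3)
    (hN : p * N₂ ≤ (1 + θ) * (N₃ + θ * n₃ / 3)) :
    p ≤ (1 + 5 * θ) * (n₃ / n₂) := by
  have hslack : p * (θ * n₃ / 3) ≤ θ * n₃ / 3 := mul_le_of_le_one_left (by positivity) hp1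
  rw [← mul_div_assoc, le_div_iff₀ hn₂]
  calc p * n₂ ≤ p * N₂ + p * (θ * n₃ / 3) := by rw [← mul_add]; gcongr
    _ ≤ (1 + θ) * (n₃ + θ * n₃ / 3 + θ * n₃ / 3) + θ * n₃ / 3 := by
        refine add_le_add (hN.trans ?_) hslack
        gcongr
    _ = (1 + 2 * θ + 2 / 3 * θ ^ 2) * n₃ := by ring
    _ ≤ (1 + 5 * θ) * n₃ := mul_le_mul_of_nonneg_right (by nlinarith) hn₃

end Scalar

namespace Concentrated

variable {S A : Type*} [Fintype S] [Fintype A] {H n : ℕ} {M : EpisodicMDP S A H} {θ x : ℝ}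
  {h : Fin H} {s : S} {a : A} {s' : S} {pol : S → A → Policy S A H} {D : Fin n → Traj S A H}

theorem visitsNext_le (hD : Concentrated M θ x h s a s' pol D) (hθ : 0 < θ) (hθ1 : θ ≤ 1) :
    (visitsNext D h s a s' : ℝ) ≤ (1 + θ) * (M.trans h s a s' * visits D h s a) + x / θ := by
  have hmul : (Real.exp θ - 1) * (M.trans h s a s' * visits D h s a) ≤
      θ * (1 + θ) * (M.trans h s a s' * visits D h s a) :=
    mul_le_mul_of_nonneg_right (exp_sub_one_le_mul_one_add hθ.le hθ1)
      (mul_nonneg (M.trans_nonneg h s a s') (Nat.cast_nonneg _))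
  rw [← mul_le_mul_iff_right₀ hθ, mul_add, mul_div_cancel₀ _ hθ.ne']
  linarith [hD.upper]

theorem trans_mul_visits_le (hD : Concentrated M θ x h s a s' pol D) (hθ : 0 < θ) :
    M.trans h s a s' * visits D h s a ≤ (1 + θ) * (visitsNext D h s a s' + x / θ) := by
  have hmul : θ * (M.trans h s a s' * visits D h s a) ≤
      (1 + θ) * (1 - Real.exp (-θ)) * (M.trans h s a s' * visits D h s a) :=
    mul_le_mul_of_nonneg_right (le_one_add_mul_one_sub_exp_neg θ)
      (mul_nonneg (M.trans_nonneg h s a s') (Nat.cast_nonneg _))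
  rw [← mul_le_mul_iff_right₀ hθ]
  calc θ * (M.trans h s a s' * visits D h s a)
      ≤ (1 + θ) * ((1 - Real.exp (-θ)) * M.trans h s a s' * visits D h s a) :=
        hmul.trans_eq (by ring)
    _ ≤ (1 + θ) * (θ * visitsNext D h s a s' + x) :=
        mul_le_mul_of_nonneg_left hD.lower.le (by positivity)
    _ = θ * ((1 + θ) * (visitsNext D h s a s' + x / θ)) := by field_simp

theorem mul_mixtureTransition_le (hD : Concentrated M θ x h s a s' pol D) :
    n * mixtureTransition M pol h s a s' ≤ 2 * (visitsNext D h s a s' + x) := by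
  have hexp : Real.exp (-1) ≤ 1 / 2 := by linarith [Real.exp_neg_one_lt_d9]
  have hmul : Real.exp (-1) * (n * mixtureTransition M pol h s a s') ≤
      1 / 2 * (n * mixtureTransition M pol h s a s') :=
    mul_le_mul_of_nonneg_right hexp
      (mul_nonneg (Nat.cast_nonneg _) (mixtureTransition_nonneg M pol h s a s'))
  linarith [hD.mixture]

end Concentrated

section AbsorbingLoss

variable {S A : Type*} [Fintype S] {H : ℕ} (M : EpisodicMDP S A H)
  (F : Set (Fin H × S × A × S)) (π : Policy S A H)

theorem occupancy_absorbingKernel_le (i : Fin (H + 1)) (s : S) :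
    occupancy M.init (restrictSome (absorbingKernel M.trans F)) π i s ≤
      occupancy M.init M.trans π i s :=
  occupancy_mono M.init_nonneg (restrictSome_absorbingKernel_nonneg M.trans_nonneg F)
    (restrictSome_absorbingKernel_le M.trans_nonneg F) π i s

theorem sum_occupancy_sub_occupancy_absorbingKernel_le {F : Set (Fin H × S × A × S)}
    {π : Policy S A H} {B : ℝ} (hB : 0 ≤ B)
    (hF : ∀ h s s', (h, s, π h s, s') ∈ F →
      occupancy M.init (restrictSome (absorbingKernel M.trans F)) π h.castSucc s *
        M.trans h s (π h s) s' ≤ B) (i : Fin (H + 1)) :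
    ∑ s, (occupancy M.init M.trans π i s -
        occupancy M.init (restrictSome (absorbingKernel M.trans F)) π i s) ≤
      H * ((Fintype.card S : ℝ) ^ 2 * B) := by
  have hloss (h : Fin H) (s s' : S) :
      occupancy M.init (restrictSome (absorbingKernel M.trans F)) π h.castSucc s *
        (M.trans h s (π h s) s' - restrictSome (absorbingKernel M.trans F) h s (π h s) s') ≤
      B := by
    by_cases hmem : (h, s, π h s, s') ∈ F
    · simpa [restrictSome_absorbingKernel, hmem] using hF h s s' hmem
    · simpa [restrictSome_absorbingKernel, hmem] using hB
  refine (sum_occupancy_sub_le (L := (Fintype.card S : ℝ) ^ 2 * B) M.trans_sum (fun h => ?_)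
    i).trans ?_
  · refine (Finset.sum_le_sum fun s _ => Finset.sum_le_sum fun s' _ => hloss h s s').trans_eq ?_
    simp [pow_two, mul_assoc]
  · gcongr
    exact i.is_le

variable [Fintype A] [Nonempty A]

theorem value_sub_valueExt_absorbingKernel (r : Fin H → S → A → ℝ) :
    value M.init M.trans π r - valueExt M.init (absorbingKernel M.trans F) π r =
      ∑ h : Fin H, ∑ s, (occupancy M.init M.trans π h.castSucc s -
        occupancy M.init (restrictSome (absorbingKernel M.trans F)) π h.castSucc s) *
          r h s (π h s) := by
  rw [value_eq_sum_occupancy _ _ M.trans_sum, valueExt_eq_sum_occupancy _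
    (sum_absorbingKernel M.trans_sum F) fun _ _ _ => rfl]
  simp only [sub_mul, Finset.sum_sub_distrib]

theorem value_sub_valueExt_absorbingKernel_nonneg {r : Fin H → S → A → ℝ}
    (hr : ∀ h s a, 0 ≤ r h s a) :
    0 ≤ value M.init M.trans π r - valueExt M.init (absorbingKernel M.trans F) π r := by
  rw [value_sub_valueExt_absorbingKernel]
  exact Finset.sum_nonneg fun h _ => Finset.sum_nonneg fun s _ =>
    mul_nonneg (sub_nonneg.2 (occupancy_absorbingKernel_le M F π _ s)) (hr h s _)

theorem value_sub_valueExt_absorbingKernel_le {F : Set (Fin H × S × A × S)}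
    {π : Policy S A H} {B : ℝ} (hB : 0 ≤ B)
    (hF : ∀ h s s', (h, s, π h s, s') ∈ F →
      occupancy M.init (restrictSome (absorbingKernel M.trans F)) π h.castSucc s *
        M.trans h s (π h s) s' ≤ B)
    {r : Fin H → S → A → ℝ} (hr : ∀ h s a, r h s a ≤ 1) :
    value M.init M.trans π r - valueExt M.init (absorbingKernel M.trans F) π r ≤
      (H : ℝ) ^ 2 * (Fintype.card S : ℝ) ^ 2 * B := by
  rw [value_sub_valueExt_absorbingKernel]
  refine (Finset.sum_le_sum fun h _ => (Finset.sum_le_sum fun s _ => mul_le_of_le_one_right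
    (sub_nonneg.2 (occupancy_absorbingKernel_le M F π h.castSucc s)) (hr h s (π h s))).trans
    (sum_occupancy_sub_occupancy_absorbingKernel_le M hB hF h.castSucc)).trans_eq ?_
  rw [Finset.sum_const, Finset.card_univ, Fintype.card_fin, nsmul_eq_mul]
  ring

end AbsorbingLoss

theorem one_le_mul_pow_mul_div_of_le {E ι : ℝ} (hE : 1 ≤ E) (hι : 1 / 2 ≤ ι) {H l : ℕ} (hl : 1 ≤ l)
    (hlH : l ≤ H) :
    1 ≤ 40 * (E * (H : ℝ) ^ 3 * ι / l) := by
  have hl0 : (0 : ℝ) < l := by exact_mod_cast hl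
  have hH : (1 : ℝ) ≤ H := by exact_mod_cast hl.trans hlH
  have hlH3 : (l : ℝ) ≤ (H : ℝ) ^ 3 :=
    (Nat.cast_le.2 hlH).trans (le_self_pow₀ hH (by norm_num))
  have hEι : 1 / 2 ≤ E * ι := by nlinarith
  rw [← mul_div_assoc, le_div_iff₀ hl0]
  nlinarith [mul_le_mul_of_nonneg_right hEι (by positivity : 0 ≤ (H : ℝ) ^ 3)]

namespace Run

variable {S A Ω : Type*} [Fintype S] [Fintype A] [Nonempty A] {H : ℕ}
  {M : EpisodicMDP S A H} [MeasurableSpace Ω] {μ : Measure Ω}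
  {K : ℕ} {len : Fin K → ℕ} {E ι : ℝ} (R : Run M μ len E ι) {k : Fin K} {ω : Ω}

/-- The crude transition estimate `P̂` of stage `k`, by which the exploration policies are
chosen. -/
noncomputable def crude (k : Fin K) (ω : Ω) : Fin H → Option S → A → Option S → ℝ :=
  crudeKernel (R.priv2 k ω) (R.priv3 k ω) (R.infreq k ω)

section Frequent

variable {R} {h : Fin H} {s : S} {a : A} {s' : S}

theorem countError_le_of_notMem_infreq (hE : 1 ≤ E) (hι : 1 / 2 ≤ ι)
    (hF : (h, s, a, s') ∉ R.infreq k ω) : E ≤ (H : ℝ)⁻¹ * R.priv3 k ω h s a s' / 3 := by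
  have hH : (1 : ℝ) ≤ H := by exact_mod_cast h.pos
  simp only [infreq, infrequent, Set.mem_ofPred_eq, not_le] at hF
  rw [inv_mul_eq_div, div_div, le_div_iff₀ (by positivity)]
  have hscale : 1 ≤ 2 * ((H : ℝ) * ι) := by nlinarith
  have := mul_le_mul_of_nonneg_left hscale (by positivity : 0 ≤ E * (H * 3))
  linarith

theorem deviation_le_of_notMem_infreq (hE : 1 ≤ E) (hι : 0 ≤ ι)
    (hF : (h, s, a, s') ∉ R.infreq k ω) :
    2 * ι / (H : ℝ)⁻¹ ≤ (H : ℝ)⁻¹ * R.priv3 k ω h s a s' / 3 := by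
  have hH : (1 : ℝ) ≤ H := by exact_mod_cast h.pos
  simp only [infreq, infrequent, Set.mem_ofPred_eq, not_le] at hF
  rw [div_inv_eq_mul, inv_mul_eq_div, div_div, le_div_iff₀ (by positivity)]
  have := mul_le_mul_of_nonneg_right hE (by positivity : 0 ≤ 6 * (H : ℝ) ^ 2 * ι)
  linarith

theorem priv3_pos_of_notMem_infreq (hE : 0 ≤ E) (hι : 0 ≤ ι)
    (hF : (h, s, a, s') ∉ R.infreq k ω) : 0 < R.priv3 k ω h s a s' := by
  simp only [infreq, infrequent, Set.mem_ofPred_eq, not_le] at hF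
  exact lt_of_le_of_lt (by positivity) hF

variable (hE : 1 ≤ E) (hι : 1 / 2 ≤ ι) (hacc : R.CountsAccurate ω)
  (hconc : Concentrated M (H : ℝ)⁻¹ (2 * ι) h s a s' (R.pol k h ω) (R.data k h ω))
  (hF : (h, s, a, s') ∉ R.infreq k ω)

include hE hι hacc hF in
theorem priv2_pos_of_notMem_infreq : 0 < R.priv2 k ω h s a := by
  have hH : (H : ℝ)⁻¹ ≤ 1 := inv_le_one_of_one_le₀ (by exact_mod_cast h.pos)
  have hn₃ := priv3_pos_of_notMem_infreq (by linarith) (by linarith) hF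
  have hslack := countError_le_of_notMem_infreq hE hι hF
  have hshrink := mul_le_of_le_one_left hn₃.le hH
  have hnext : (visitsNext (R.data k h ω) h s a s' : ℝ) ≤ visits (R.data k h ω) h s a :=
    Nat.cast_le.2 (visitsNext_le_visits _ _ _ _ _)
  linarith [(hacc k h s a).1.1, (abs_le.1 ((hacc k h s a).2 s')).2]

include hE hι hacc hconc hF

theorem priv3_div_priv2_le :
    R.priv3 k ω h s a s' / R.priv2 k ω h s a ≤ (1 + 5 / H) * M.trans h s a s' := by
  have hH : (1 : ℝ) ≤ H := by exact_mod_cast h.pos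
  rw [div_eq_mul_inv 5]
  refine div_le_one_add_mul_of_count_le (by positivity) (inv_le_one_of_one_le₀ hH)
    (M.trans_nonneg h s a s') (priv2_pos_of_notMem_infreq hE hι hacc hF)
    (priv3_pos_of_notMem_infreq (by linarith) (by linarith) hF).le (hacc k h s a).1.1 ?_
    ((hconc.visitsNext_le (by positivity) (inv_le_one_of_one_le₀ hH)).trans
      (add_le_add_right (deviation_le_of_notMem_infreq hE (by linarith) hF) _))
  linarith [(abs_le.1 ((hacc k h s a).2 s')).2, countError_le_of_notMem_infreq hE hι hF]

theorem trans_le_priv3_div_priv2 :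
    M.trans h s a s' ≤ (1 + 5 / H) * (R.priv3 k ω h s a s' / R.priv2 k ω h s a) := by
  have hH : (1 : ℝ) ≤ H := by exact_mod_cast h.pos
  have hslack := countError_le_of_notMem_infreq hE hι hF
  have hcount := hconc.trans_mul_visits_le (by positivity)
  rw [div_eq_mul_inv 5]
  refine le_one_add_mul_div_of_le_count (by positivity) (inv_le_one_of_one_le₀ hH)
    (M.trans_nonneg h s a s') (M.trans_le_one h s a s')
    (priv2_pos_of_notMem_infreq hE hι hacc hF)
    (priv3_pos_of_notMem_infreq (by linarith) (by linarith) hF).le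
    (N₂ := visits (R.data k h ω) h s a) (N₃ := visitsNext (R.data k h ω) h s a s') ?_ ?_
    (hcount.trans (mul_le_mul_of_nonneg_left ?_ (by positivity)))
  · linarith [(hacc k h s a).1.2]
  · linarith [(abs_le.1 ((hacc k h s a).2 s')).1]
  · linarith [deviation_le_of_notMem_infreq hE (by linarith) hF]

end Frequent

section Accurate

variable (hE : 1 ≤ E) (hι : 1 / 2 ≤ ι) (hacc : R.CountsAccurate ω)

include hE hι hacc in
theorem restrictSome_crude_nonneg (h : Fin H) (s : S) (a : A) (s' : S) :
    0 ≤ restrictSome (R.crude k ω) h s a s' := by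
  rw [crude, restrictSome_crudeKernel]
  split_ifs with hF
  · exact le_rfl
  · exact div_nonneg (priv3_pos_of_notMem_infreq (by linarith) (by linarith) hF).le
      (priv2_pos_of_notMem_infreq hE hι hacc hF).le

variable (hconc : ∀ h s a s',
  Concentrated M (H : ℝ)⁻¹ (2 * ι) h s a s' (R.pol k h ω) (R.data k h ω))

include hE hι hacc hconc

theorem restrictSome_crude_le (h : Fin H) (s : S) (a : A) (s' : S) :
    restrictSome (R.crude k ω) h s a s' ≤
      (1 + 5 / H) * restrictSome (R.absorbing k ω) h s a s' := by
  rw [crude, absorbing, restrictSome_crudeKernel, restrictSome_absorbingKernel]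
  split_ifs with hF
  · rw [mul_zero]
  · exact priv3_div_priv2_le hE hι hacc (hconc h s a s') hF

theorem restrictSome_absorbing_le (h : Fin H) (s : S) (a : A) (s' : S) :
    restrictSome (R.absorbing k ω) h s a s' ≤
      (1 + 5 / H) * restrictSome (R.crude k ω) h s a s' := by
  rw [crude, absorbing, restrictSome_crudeKernel, restrictSome_absorbingKernel]
  split_ifs with hF
  · rw [mul_zero]
  · exact trans_le_priv3_div_priv2 hE hι hacc (hconc h s a s') hF

theorem occupancy_absorbing_le_visitProb {π : Policy S A H} (hπ : π ∈ R.active k ω) (h : Fin H)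
    (s : S) :
    occupancy M.init (restrictSome (R.absorbing k ω)) π h.castSucc s ≤
      Real.exp 10 * visitProb M.init M.trans (R.pol k h ω s (π h s)) h s (π h s) := by
  have hvalue (σ : Policy S A H) :=
    valueExt_indicatorReward M.init (sum_crudeKernel (R.priv2 k ω) (R.priv3 k ω) (R.infreq k ω))
      (fun _ _ _ => rfl) σ h s (π h s)
  have hmax : visitProb M.init (restrictSome (R.crude k ω)) π h s (π h s) ≤
      visitProb M.init (restrictSome (R.crude k ω)) (R.pol k h ω s (π h s)) h s (π h s) := by
    rw [crude, ← hvalue, ← hvalue]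
    exact (R.pol_argmax k h ω s (π h s)).1 hπ
  have hnonneg := restrictSome_absorbingKernel_nonneg M.trans_nonneg (R.infreq k ω)
  have hcover := visitProb_le_exp_mul_of_visitProb_le (c := 5) (by norm_num) M.init_nonneg hnonneg
    (R.restrictSome_crude_nonneg hE hι hacc) (R.restrictSome_absorbing_le hE hι hacc hconc)
    (R.restrictSome_crude_le hE hι hacc hconc) hmax
  rw [visitProb_self, show (2 : ℝ) * 5 = 10 by norm_num] at hcover
  refine hcover.trans (mul_le_mul_of_nonneg_left ?_ (Real.exp_pos _).le)
  exact visitProb_mono M.init_nonneg hnonneg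
    (restrictSome_absorbingKernel_le M.trans_nonneg (R.infreq k ω)) _ h s _

end Accurate

theorem mixtureTransition_le_of_mem_infreq {R : Run M μ len E ι} (hE : 1 ≤ E) (hι : 1 / 2 ≤ ι)
    (hacc : R.CountsAccurate ω) (hlen : H ≤ len k) {θ : ℝ} {h : Fin H} {s : S} {a : A} {s' : S}
    (hconc : Concentrated M θ (2 * ι) h s a s' (R.pol k h ω) (R.data k h ω))
    (hF : (h, s, a, s') ∈ R.infreq k ω) :
    mixtureTransition M (R.pol k h ω) h s a s' ≤ 40 * (E * (H : ℝ) ^ 3 * ι / len k) := by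
  set q := mixtureTransition M (R.pol k h ω) h s a s'
  have hq : 0 ≤ q := mixtureTransition_nonneg M _ h s a s'
  have hH : (1 : ℝ) ≤ H := by exact_mod_cast h.pos
  have hlen0 : (0 : ℝ) < len k := by exact_mod_cast h.pos.trans_le hlen
  have hbatch : (len k : ℝ) ≤ 2 * H * (len k / H : ℕ) := by
    have hone : 1 ≤ len k / H := (Nat.one_le_div_iff h.pos).2 hlen
    have hdiv := Nat.lt_div_mul_add (a := len k) h.pos
    exact_mod_cast (by nlinarith : len k ≤ 2 * H * (len k / H))
  have hcount : (len k / H : ℕ) * q ≤ 20 * (E * (H : ℝ) ^ 2 * ι) := by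
    have hnext := (abs_le.1 ((hacc k h s a).2 s')).1
    have hmean := hconc.mul_mixtureTransition_le
    have hEι : E * ι ≤ E * (H : ℝ) ^ 2 * ι := by
      rw [mul_right_comm]
      exact le_mul_of_one_le_right (by positivity) (one_le_pow₀ hH)
    simp only [infreq, infrequent, Set.mem_ofPred_eq] at hF
    nlinarith
  rw [← mul_div_assoc, le_div_iff₀ hlen0]
  calc q * len k ≤ q * (2 * H * (len k / H : ℕ)) := by gcongr
    _ = 2 * H * ((len k / H : ℕ) * q) := by ring
    _ ≤ 2 * H * (20 * (E * (H : ℝ) ^ 2 * ι)) := by gcongr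
    _ = 40 * (E * (H : ℝ) ^ 3 * ι) := by ring

section Loss

variable (hE : 1 ≤ E) (hι : 1 / 2 ≤ ι) (hlen : 1 ≤ len k) (hacc : R.CountsAccurate ω)
  (hconc : ∀ h s a s', Concentrated M (H : ℝ)⁻¹ (2 * ι) h s a s' (R.pol k h ω) (R.data k h ω))
  {π : Policy S A H} (hπ : π ∈ R.active k ω)

include hE hι hlen hacc hconc hπ

theorem occupancy_absorbing_mul_trans_le {h : Fin H} {s s' : S}
    (hF : (h, s, π h s, s') ∈ R.infreq k ω) :
    occupancy M.init (restrictSome (R.absorbing k ω)) π h.castSucc s * M.trans h s (π h s) s' ≤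
      Real.exp 10 * (Fintype.card S * Fintype.card A * (40 * (E * (H : ℝ) ^ 3 * ι / len k))) := by
  have := M.nonempty_state
  have hcard : (1 : ℝ) ≤ Fintype.card S * Fintype.card A := by
    exact_mod_cast Nat.mul_pos Fintype.card_pos Fintype.card_pos
  rcases le_total H (len k) with hH | hH
  · calc occupancy M.init (restrictSome (R.absorbing k ω)) π h.castSucc s *
          M.trans h s (π h s) s'
        ≤ Real.exp 10 * visitProb M.init M.trans (R.pol k h ω s (π h s)) h s (π h s) *
            M.trans h s (π h s) s' :=
          mul_le_mul_of_nonneg_right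
            (R.occupancy_absorbing_le_visitProb hE hι hacc hconc hπ h s) (M.trans_nonneg _ _ _ _)
      _ ≤ Real.exp 10 * (Fintype.card S * Fintype.card A *
            mixtureTransition M (R.pol k h ω) h s (π h s) s') := by
          rw [mul_assoc]
          refine mul_le_mul_of_nonneg_left ?_ (Real.exp_pos _).le
          exact visitProb_mul_trans_le_mixtureTransition M _ h s (π h s) s'
      _ ≤ _ := by
          gcongr
          exact mixtureTransition_le_of_mem_infreq hE hι hacc hH (hconc h s (π h s) s') hF
  · calc occupancy M.init (restrictSome (R.absorbing k ω)) π h.castSucc s *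
          M.trans h s (π h s) s'
        ≤ 1 := mul_le_one₀ ((occupancy_absorbingKernel_le M _ π _ s).trans
          (M.occupancy_le_one π _ s)) (M.trans_nonneg _ _ _ _) (M.trans_le_one _ _ _ _)
      _ ≤ _ := one_le_mul_of_one_le_of_one_le (Real.one_le_exp (by norm_num))
          (one_le_mul_of_one_le_of_one_le hcard (one_le_mul_pow_mul_div_of_le hE hι hlen hH))

theorem value_sub_valueExt_absorbing_le {r : Fin H → S → A → ℝ} (hr : ∀ h s a, r h s a ≤ 1) :
    value M.init M.trans π r - valueExt M.init (R.absorbing k ω) π r ≤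
      40 * Real.exp 10 * (E * (Fintype.card S : ℝ) ^ 3 * (Fintype.card A : ℝ) * (H : ℝ) ^ 5 *
        ι / (len k : ℝ)) :=
  (value_sub_valueExt_absorbingKernel_le M (by positivity)
    (fun _ _ _ hF => R.occupancy_absorbing_mul_trans_le hE hι hlen hacc hconc hπ hF)
    hr).trans_eq (by ring)

end Loss

end Run

section UnionBound

variable {S A : Type*} [Fintype S] [Fintype A]

theorem one_le_three_mul_exp_neg {K H : ℕ} {ι : ℝ} [Nonempty S] [Nonempty A] (hK : 0 < K)
    (hH : 0 < H) (hι : ι ≤ 1 / 2) :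
    1 ≤ 3 * (K * H * (Fintype.card S : ℝ) ^ 2 * Fintype.card A) * Real.exp (-(2 * ι)) := by
  have hcard : (1 : ℝ) ≤ K * H * (Fintype.card S : ℝ) ^ 2 * Fintype.card A := by
    have : 1 ≤ K * H * Fintype.card S ^ 2 * Fintype.card A :=
      Nat.mul_pos (Nat.mul_pos (Nat.mul_pos hK hH) (pow_pos Fintype.card_pos 2)) Fintype.card_pos
    exact_mod_cast this
  have hexp : 1 / 3 ≤ Real.exp (-(2 * ι)) :=
    calc (1 / 3 : ℝ) ≤ Real.exp (-1) := by linarith [Real.exp_neg_one_gt_d9]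
      _ ≤ Real.exp (-(2 * ι)) := Real.exp_le_exp.2 (by linarith)
  linarith [mul_le_mul_of_nonneg_left hexp (by linarith : 0 ≤ 3 * (K * H *
    (Fintype.card S : ℝ) ^ 2 * Fintype.card A)), Real.exp_pos (-(2 * ι))]

theorem exp_neg_logFactor [Nonempty S] [Nonempty A] {H T : ℕ} {δ : ℝ} (hH : 0 < H) (hT : 0 < T)
    (hδ : 0 < δ) :
    Real.exp (-logFactor S A H T δ) =
      δ / (2 * (Fintype.card S : ℝ) * (Fintype.card A : ℝ) * (H : ℝ) * (T : ℝ)) := by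
  rw [logFactor, Real.exp_neg, Real.exp_log (by positivity), inv_div]

theorem three_mul_exp_neg_two_mul_logFactor_le [Nonempty S] [Nonempty A] {K H T : ℕ} {δ : ℝ}
    (hKT : K ≤ T) (hδ : 0 < δ) (hδ1 : δ ≤ 1) :
    3 * (K * H * (Fintype.card S : ℝ) ^ 2 * Fintype.card A) *
      Real.exp (-(2 * logFactor S A H T δ)) ≤ δ := by
  rcases K.eq_zero_or_pos with rfl | hK
  · simpa using hδ.le
  rcases H.eq_zero_or_pos with rfl | hH
  · simpa using hδ.le
  have hT := hK.trans_le hKT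
  have hA : (1 : ℝ) ≤ Fintype.card A := by exact_mod_cast Fintype.card_pos (α := A)
  have hH' : (1 : ℝ) ≤ H := by exact_mod_cast hH
  have hT' : (1 : ℝ) ≤ T := by exact_mod_cast hT
  have hKT' : (K : ℝ) ≤ T := by exact_mod_cast hKT
  have hexp : Real.exp (-(2 * logFactor S A H T δ)) =
      (δ / (2 * (Fintype.card S : ℝ) * (Fintype.card A : ℝ) * (H : ℝ) * (T : ℝ))) ^ 2 := by
    rw [← exp_neg_logFactor hH hT hδ, ← Real.exp_nat_mul]
    congr 1
    push_cast
    ring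
  rw [hexp, div_pow, ← mul_div_assoc, div_le_iff₀ (by positivity)]
  have hδsq : δ ^ 2 ≤ δ := by nlinarith
  have hcount : 3 * (K * H * (Fintype.card S : ℝ) ^ 2 * Fintype.card A) ≤
      (2 * (Fintype.card S : ℝ) * (Fintype.card A : ℝ) * (H : ℝ) * (T : ℝ)) ^ 2 := by
    have hKTsq : (K : ℝ) ≤ (T : ℝ) ^ 2 := hKT'.trans (le_self_pow₀ hT' two_ne_zero)
    have hHsq : (H : ℝ) ≤ (H : ℝ) ^ 2 := le_self_pow₀ hH' two_ne_zero
    have hAsq : (Fintype.card A : ℝ) ≤ (Fintype.card A : ℝ) ^ 2 := le_self_pow₀ hA two_ne_zero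
    calc 3 * (K * H * (Fintype.card S : ℝ) ^ 2 * Fintype.card A)
        ≤ 4 * ((T : ℝ) ^ 2 * (H : ℝ) ^ 2 * (Fintype.card S : ℝ) ^ 2 *
            (Fintype.card A : ℝ) ^ 2) := by
          gcongr
          norm_num
      _ = (2 * (Fintype.card S : ℝ) * (Fintype.card A : ℝ) * (H : ℝ) * (T : ℝ)) ^ 2 := by ring
  rw [mul_comm δ]
  exact mul_le_mul hcount hδsq (by positivity) (by positivity)

end UnionBound

end PrivateRL

open PrivateRL in
theorem mainTheorem1_general {S A Ω : Type*} [Fintype S] [Fintype A] [Nonempty A]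
    [MeasurableSpace Ω] (μ : Measure Ω) [IsProbabilityMeasure μ] {H K : ℕ} {len : Fin K → ℕ}
    {E ι : ℝ} {M : EpisodicMDP S A H} (R : Run M μ len E ι) (hE : 1 ≤ E)
    (hlen : ∀ k, 1 ≤ len k) :
    μ {ω | ¬ ∀ k : Fin K, ∀ π ∈ R.active k ω, ∀ r' : Fin H → S → A → ℝ,
        (∀ h s a, 0 ≤ r' h s a ∧ r' h s a ≤ 1) →
        0 ≤ value M.init M.trans π r' - valueExt M.init (R.absorbing k ω) π r' ∧
        value M.init M.trans π r' - valueExt M.init (R.absorbing k ω) π r' ≤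
          40 * Real.exp 10 * (E * (Fintype.card S : ℝ) ^ 3 * (Fintype.card A : ℝ) *
            (H : ℝ) ^ 5 * ι / (len k : ℝ))} ≤
      μ {ω | ¬ R.CountsAccurate ω} +
        ENNReal.ofReal (3 * (K * H * (Fintype.card S : ℝ) ^ 2 * Fintype.card A) *
          Real.exp (-(2 * ι))) := by
  have := M.nonempty_state
  rcases K.eq_zero_or_pos with rfl | hK
  · simp
  rcases H.eq_zero_or_pos with rfl | hH
  · simp [value, valueExt]
  rcases le_total ι (1 / 2) with hι | hι
  · calc _ ≤ 1 := prob_le_one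
      _ ≤ ENNReal.ofReal _ := ENNReal.one_le_ofReal.2 (one_le_three_mul_exp_neg hK hH hι)
      _ ≤ _ := le_add_self
  refine (measure_mono fun ω hω => ?_).trans ((measure_union_le {ω | ¬ R.CountsAccurate ω} _).trans
    (add_le_add_right ((ENNReal.le_ofReal_iff_toReal_le (measure_ne_top _ _) (by positivity)).2
      (R.measureReal_not_forall_concentrated_le (H : ℝ)⁻¹ (2 * ι))) _))
  by_contra hgood
  simp only [Set.mem_union, Set.mem_ofPred_eq, not_or, not_not] at hgood
  exact hω fun k π hπ r hr =>
    ⟨value_sub_valueExt_absorbingKernel_nonneg M _ π fun h s a => (hr h s a).1,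
      R.value_sub_valueExt_absorbing_le hE hι (hlen k) hgood.1 (hgood.2 k) hπ
        fun h s a => (hr h s a).2⟩

theorem mainTheorem1 :
    ∃ C : ℝ, 0 < C ∧
      ∀ {S A Ω : Type*} [Fintype S] [Fintype A] [Nonempty A] [MeasurableSpace Ω]
        (μ : Measure Ω) [IsProbabilityMeasure μ]
        (H K T : ℕ) (len : Fin K → ℕ) (δ E : ℝ)
        (M : PrivateRL.EpisodicMDP S A H)
        (R : PrivateRL.Run M μ len E (PrivateRL.logFactor S A H T δ)),
        0 < δ → δ < 1 → 1 ≤ E →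
        (∀ k, 1 ≤ len k) → ∑ k, len k ≤ T →
        μ {ω | ¬ R.CountsAccurate ω} ≤ ENNReal.ofReal (3 * δ) →
        μ {ω | ¬ ∀ k : Fin K, ∀ π ∈ R.active k ω, ∀ r' : Fin H → S → A → ℝ,
            (∀ h s a, 0 ≤ r' h s a ∧ r' h s a ≤ 1) →
            0 ≤ PrivateRL.value M.init M.trans π r' -
                  PrivateRL.valueExt M.init (R.absorbing k ω) π r' ∧
            PrivateRL.value M.init M.trans π r' -
                  PrivateRL.valueExt M.init (R.absorbing k ω) π r' ≤
              C * (E * (Fintype.card S : ℝ) ^ 3 * (Fintype.card A : ℝ) * (H : ℝ) ^ 5 *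
                PrivateRL.logFactor S A H T δ / (len k : ℝ))} ≤
          ENNReal.ofReal (7 * δ) := by
  refine ⟨40 * Real.exp 10, by positivity, ?_⟩
  intro S A Ω _ _ _ _ μ _ H K T len δ E M R hδ hδ1 hE hlen hsum hacc
  have := M.nonempty_state
  have hKT : K ≤ T :=
    calc K = ∑ _k : Fin K, 1 := by simp
      _ ≤ ∑ k, len k := Finset.sum_le_sum fun k _ => hlen k
      _ ≤ T := hsum
  calc _ ≤ _ := mainTheorem1_general μ R hE hlen
    _ ≤ ENNReal.ofReal (3 * δ) + ENNReal.ofReal δ := add_le_add hacc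
        (ENNReal.ofReal_le_ofReal (PrivateRL.three_mul_exp_neg_two_mul_logFactor_le hKT hδ hδ1.le))
    _ ≤ ENNReal.ofReal (7 * δ) := by
        rw [← ENNReal.ofReal_add (by positivity) hδ.le]
        exact ENNReal.ofReal_le_ofReal (by linarith)
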